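/- For a sequence $\alpha=(\alpha(i))_{i\in\mathbb N}$ of integers $\alpha(i)\ge 2$, let $T_\alpha$ be the rooted tree in which every vertex at distance $i$ from the root has exactly $\alpha(i)$ children, let $V_n$ be the set of vertices at distance $n$ from the root (level $n$), and let $\mathrm{Aut}(T_\alpha)$ be the group of graph automorphisms of $T_\alpha$ fixing the root, with the (profinite) topology of pointwise convergence on vertices. For a closed subgroup $G\le \mathrm{Aut}(T_\alpha)$ and a vertex $v$, let $\mathrm{rist}_G(v)$ be the group of all $g\in G$ fixing every vertex outside the subtree $T_\alpha^v$ of vertices whose path to the root passes through $v$ (including $v$ itself), and let $\mathrm{rist}_G(n)=\langle \mathrm{rist}_G(v) \mid v\in V_n\rangle$. A profinite group $G$ is a \emph{profinite branch group} if, for some such $\alpha$, it is isomorphic as a topological group to a closed subgroup of $\mathrm{Aut}(T_\alpha)$ which acts transitively on each level $V_n$ and whose subgroups $\mathrm{rist}_G(n)$ all have finite index. A topological group is \emph{strongly just infinite} if each of its non-trivial normal subgroups (closed or not) is open and of finite index. \textbf{Theorem.} Let $G$ be a strongly just infinite profinite branch group. Then there are exactly two topologies on the abstract group $G$ that make it a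 locally compact Hausdorff topological group: the discrete topology and the given profinite topology of $G$ (and these two are different). -/

import Mathlib

namespace BranchGroup

/-- Vertices of the spherically homogeneous rooted tree `T_α` in which every vertex of level `i` has
`α i` children: a vertex of level `n` is a sequence `(a₀, …, aₙ₋₁)` with `aᵢ < α i`. -/
structure Vertex (α : ℕ → ℕ) where
  /-- the level, i.e. the distance to the root -/
  level : ℕ
  /-- the sequence of choices leading from the root to the vertex -/
  path : ∀ i : Fin level, Fin (α i)

/-- The root of `T_α`: the empty sequence. -/
def root (α : ℕ → ℕ) : Vertex α := ⟨0, fun i => i.elim0⟩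

/-- The tree order `v ≤ w`: `v` lies on the path from the root to `w`, i.e. `v` is an initial
segment of `w`. -/
def IsPrefix {α : ℕ → ℕ} (v w : Vertex α) : Prop :=
  ∃ h : v.level ≤ w.level, ∀ i : Fin v.level, w.path (Fin.castLE h i) = v.path i

/-- `w` is a child of `v`. -/
def IsChild {α : ℕ → ℕ} (v w : Vertex α) : Prop :=
  w.level = v.level + 1 ∧ IsPrefix v w

/-- The spherically homogeneous tree `T_α` as a graph. -/
def tree (α : ℕ → ℕ) : SimpleGraph (Vertex α) where
  Adj v w := IsChild v w ∨ IsChild w v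
  symm := ⟨fun _ _ h => h.symm⟩
  loopless := ⟨fun v h => by rcases h with h | h <;> exact absurd h.1 (by omega)⟩

/-- `Aut(T_α)`: the group of graph automorphisms of `T_α` that fix the root. -/
def treeAut (α : ℕ → ℕ) : Subgroup (tree α ≃g tree α) where
  carrier := {g | g (root α) = root α}
  one_mem' := rfl
  mul_mem' {g h} hg hh := by
    change g (h (root α)) = root α
    rw [show h (root α) = root α from hh]
    exact hg
  inv_mem' {g} hg := by
    change g.symm (root α) = root α
    exact (RelIso.symm_apply_eq g).2 (Eq.symm hg)

/-- The (profinite) topology of `Aut(T_α)`: pointwise convergence on the discrete set of vertices. -/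
instance treeAut.instTopologicalSpace (α : ℕ → ℕ) : TopologicalSpace (treeAut α) :=
  TopologicalSpace.induced (fun (g : treeAut α) (v : Vertex α) => g.1 v)
    (@Pi.topologicalSpace (Vertex α) (fun _ => Vertex α) (fun _ => ⊥))

/-- The rigid stabilizer of the vertex `v` in `H ≤ Aut(T_α)`: the elements of `H` that fix every
vertex outside of the subtree below `v`. -/
def rigidStabilizer {α : ℕ → ℕ} (H : Subgroup (treeAut α)) (v : Vertex α) : Subgroup H where
  carrier := {g | ∀ w : Vertex α, ¬ IsPrefix v w → g.1.1 w = w}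
  one_mem' := fun _ _ => rfl
  mul_mem' {g h} hg hh w hw := by
    change g.1.1 (h.1.1 w) = w
    rw [hh w hw, hg w hw]
  inv_mem' {g} hg w hw := by
    change g.1.1.symm w = w
    exact (RelIso.symm_apply_eq g.1.1).2 (Eq.symm (hg w hw))

/-- The `n`-th rigid level stabilizer in `H`: the subgroup generated by the rigid stabilizers of the
vertices of level `n`. -/
def rigidLevelStabilizer {α : ℕ → ℕ} (H : Subgroup (treeAut α)) (n : ℕ) : Subgroup H :=
  ⨆ (v : Vertex α) (_ : v.level = n), rigidStabilizer H v

/-- A profinite group `G` is a profinite branch group if, for some `α` with all `α i ≥ 2`, it is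
isomorphic as a topological group to a closed subgroup `H` of `Aut(T_α)` that acts transitively on
every level and all of whose rigid level stabilizers have finite index. -/
def IsProfiniteBranchGroup (G : Type*) [Group G] [TopologicalSpace G] : Prop :=
  IsTopologicalGroup G ∧ CompactSpace G ∧ TotallyDisconnectedSpace G ∧
  ∃ α : ℕ → ℕ, (∀ i, 2 ≤ α i) ∧
    ∃ H : Subgroup (treeAut α), IsClosed (H : Set (treeAut α)) ∧ Nonempty (G ≃ₜ* H) ∧
      (∀ v w : Vertex α, v.level = w.level → ∃ g : H, g.1.1 v = w) ∧
      ∀ n : ℕ, (rigidLevelStabilizer H n).FiniteIndex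

/-- A topological group is strongly just infinite if every non-trivial normal subgroup (closed or
not) is open and of finite index. -/
def IsStronglyJustInfinite (G : Type*) [Group G] [TopologicalSpace G] : Prop :=
  ∀ N : Subgroup G, N.Normal → N ≠ ⊥ → IsOpen (N : Set G) ∧ N.FiniteIndex

/-- The topology `t` on the abstract group `G` is a locally compact Hausdorff group topology. -/
def IsLocallyCompactGroupTopology (G : Type*) [Group G] (t : TopologicalSpace G) : Prop :=
  @IsTopologicalGroup G t _ ∧ @LocallyCompactSpace G t ∧ @T2Space G t

end BranchGroup

/-!
The theorem combines two facts.

*Every Hausdorff group topology on a branch group is finer than the profinite one*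
(`continuous_of_t2`). Centralizers are closed in any Hausdorff group topology. All rigid stabilizers
are non-trivial (`rigidStabilizer_ne_bot`), and this makes the stabilizer of a vertex `v` visible in
the abstract group: it is the set of all `g` that conjugate the centralizer of the rigid stabilizer
of `v` into itself (`apply_eq_self_iff`). Hence vertex stabilizers are closed; having finite index,
they are open.

*If a locally compact group topology `t` on a strongly just infinite, first countable profinite group
is finer than the profinite topology, then it is discrete or compact*
(`discrete_or_compact_of_continuous`). The topologies coincide on `t`-compact sets, so there is a
`t`-compact `t`-open subgroup `U`, closed in the profinite topology. For each `g`, the subgroup `U`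
contains `g (U ∩ B) g⁻¹` for some member `B` of a countable base at `1`. By Baire's theorem one `B`
serves for all `g` in some coset `L g₀`, with `L` an open normal subgroup that may be taken inside
`B`. So all the conjugates by elements of `L` of `g₀ (U ∩ L) g₀⁻¹` lie in `U ∩ L`, and the closed
subgroup `M` that they generate is compact and normal in `L`. If `U ∩ L` is trivial, `t` is discrete.
Otherwise `M` is non-trivial, and its finitely many conjugates generate a compact normal subgroup of
the whole group (`exists_compact_normal_ge`). As the group is strongly just infinite, that subgroup
has finite index, so `t` is compact.

A compact topology finer than a Hausdorff one is equal to it.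
-/

namespace BranchGroup

/-! ### Locally compact topologies finer than a profinite one -/

open Topology in
/-- The domain of `f` carries, up to the isomorphism `f`, a finer topology than the profinite group
`G`; on a compact set `K` the two agree at `1`. -/
theorem exists_openNormalSubgroup_inter_preimage_subset {X G : Type*} [Group X]
    [TopologicalSpace X] [Group G] [TopologicalSpace G] [IsTopologicalGroup G] [CompactSpace G]
    [T2Space G] [TotallyDisconnectedSpace G] (f : X ≃* G) (hf : Continuous f)
    {K V : Set X} (hK : IsCompact K) (hV : V ∈ 𝓝 (1 : X)) :
    ∃ L : OpenNormalSubgroup G, ∀ x ∈ K, f x ∈ L → x ∈ V := by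
  have hc : IsClosed (f '' (K \ interior V)) :=
    ((hK.diff isOpen_interior).image hf).isClosed
  obtain ⟨L, hL⟩ := ProfiniteGrp.exist_openNormalSubgroup_sub_open_nhds_of_one hc.isOpen_compl
    (by
      rintro ⟨x, hx, h1⟩
      rw [map_eq_one_iff f f.injective] at h1
      exact hx.2 (h1 ▸ mem_interior_iff_mem_nhds.2 hV))
  refine ⟨L, fun x hx hxL => ?_⟩
  by_contra hxV
  exact hL hxL ⟨x, ⟨hx, fun h => hxV (interior_subset h)⟩, rfl⟩

open Topology Pointwise in
/-- A form of van Dantzig's theorem, for a locally compact topology finer than a profinite one. -/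
theorem exists_compact_open_subgroup {X G : Type*} [Group X]
    [TopologicalSpace X] [IsTopologicalGroup X] [LocallyCompactSpace X] [Group G]
    [TopologicalSpace G] [IsTopologicalGroup G] [CompactSpace G]
    [T2Space G] [TotallyDisconnectedSpace G] (f : X ≃* G) (hf : Continuous f) :
    ∃ U : Subgroup X, IsOpen (U : Set X) ∧ IsCompact (U : Set X) := by
  obtain ⟨K, hK, hK1⟩ := exists_compact_mem_nhds (1 : X)
  obtain ⟨L, hL⟩ := exists_openNormalSubgroup_inter_preimage_subset f hf hK
    (interior_mem_nhds.2 hK1)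
  have hLc : IsClosed (f ⁻¹' (L : Set G)) := L.toOpenSubgroup.isClosed.preimage hf
  have hLo : IsOpen (f ⁻¹' (L : Set G)) := L.toOpenSubgroup.isOpen.preimage hf
  let C : Set X := K ∩ f ⁻¹' (L : Set G)
  have hCc : IsCompact C := hK.inter_right hLc
  have hCo : IsOpen C := by
    have : C = interior K ∩ f ⁻¹' (L : Set G) := by
      ext x
      exact ⟨fun h => ⟨hL x h.1 h.2, h.2⟩, fun h => ⟨interior_subset h.1, h.2⟩⟩
    rw [this]
    exact isOpen_interior.inter hLo
  have hC1 : (1 : X) ∈ C := ⟨mem_of_mem_nhds hK1, by simp⟩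
  obtain ⟨V, hV, hVC⟩ := compact_open_separated_mul_left hCc hCo subset_rfl
  -- the elements `x` with `x C = C` form an open subgroup inside of `C`
  have hT : IsOpen (MulAction.stabilizer X C : Set X) := by
    refine Subgroup.isOpen_of_mem_nhds _ (g := 1)
      (Filter.mem_of_superset (Filter.inter_mem hV (inv_mem_nhds_one X hV)) ?_)
    rintro x ⟨hx, hx'⟩
    refine MulAction.mem_stabilizer_iff.2 (subset_antisymm ?_ ?_)
    · rintro _ ⟨c, hc, rfl⟩
      exact hVC (Set.mul_mem_mul hx hc)
    · intro c hc
      exact Set.mem_smul_set_iff_inv_smul_mem.2 (hVC (Set.mul_mem_mul hx' hc))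
  refine ⟨MulAction.stabilizer X C, hT, hCc.of_isClosed_subset
    (Subgroup.isClosed_of_isOpen _ hT) fun x hx => ?_⟩
  rw [← MulAction.mem_stabilizer_iff.1 hx]
  exact ⟨1, hC1, mul_one x⟩

/-- Finitely many compact subgroups of `L` that are normalized by `L` generate a compact subgroup,
namely their product. -/
theorem isCompact_finset_sup {X ι : Type*} [Group X] [TopologicalSpace X] [IsTopologicalGroup X]
    {L : Subgroup X} (F : Finset ι) (M : ι → Subgroup X) (hle : ∀ i, M i ≤ L)
    (hn : ∀ i, L ≤ Subgroup.normalizer (M i : Set X)) (hc : ∀ i, IsCompact (M i : Set X)) :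
    IsCompact ((F.sup M : Subgroup X) : Set X) := by
  classical
  induction F using Finset.induction_on with
  | empty => simp
  | insert i F _ ih =>
    have hF : F.sup M ≤ L := Finset.sup_le fun j _ => hle j
    rw [Finset.sup_insert, sup_comm,
      Subgroup.coe_mul_of_left_le_normalizer_right _ _ (hF.trans (hn i))]
    exact ih.mul (hc i)

/-- A compact subgroup `M` that is normalized by a normal subgroup `L ≥ M` of finite index lies in a
compact normal subgroup: its finitely many conjugates normalize each other. -/
theorem exists_compact_normal_ge {X : Type*} [Group X] [TopologicalSpace X] [IsTopologicalGroup X]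
    {L M : Subgroup X} (hLn : L.Normal) (hLi : L.FiniteIndex) (hML : M ≤ L)
    (hMn : ∀ s ∈ L, ∀ x ∈ M, s * x * s⁻¹ ∈ M) (hMc : IsCompact (M : Set X)) :
    ∃ N : Subgroup X, N.Normal ∧ M ≤ N ∧ IsCompact (N : Set X) := by
  -- the conjugate `c g` of `M` depends only on the coset `g L`
  let c : X → Subgroup X := fun g => M.map (MulAut.conj g).toMonoidHom
  have hmem : ∀ g x, x ∈ c g ↔ g⁻¹ * x * g ∈ M := fun g x => by
    refine ⟨?_, fun h => ⟨_, h, by simp [mul_assoc]⟩⟩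
    rintro ⟨m, hm, rfl⟩
    simpa [mul_assoc] using hm
  have hcle : ∀ g, c g ≤ L := fun g x hx => by
    have := hLn.conj_mem _ (hML ((hmem g x).1 hx)) g
    simpa [mul_assoc] using this
  have hcmul : ∀ g, ∀ s ∈ L, c (g * s) = c g := fun g s hs => by
    ext x
    rw [hmem, hmem]
    constructor
    · intro h
      have := hMn s hs _ h
      simpa [mul_assoc] using this
    · intro h
      have := hMn s⁻¹ (L.inv_mem hs) _ h
      simpa [mul_assoc] using this
  have hccn : ∀ g, L ≤ Subgroup.normalizer (c g : Set X) := fun g => by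
    rw [Subgroup.le_normalizer_iff]
    intro s hs x hx
    rw [hmem] at hx ⊢
    have := hMn (g⁻¹ * s * g) (by simpa using hLn.conj_mem s hs g⁻¹) _ hx
    simpa [mul_assoc] using this
  have hcc : ∀ g, IsCompact (c g : Set X) := fun g =>
    hMc.image (show Continuous fun x => g * x * g⁻¹ by fun_prop)
  have : Fintype (X ⧸ L) := Fintype.ofFinite _
  let N : Subgroup X := Finset.univ.sup fun q : X ⧸ L => c q.out
  have hNc : IsCompact (N : Set X) :=
    isCompact_finset_sup _ _ (fun q => hcle _) (fun q => hccn _) fun q => hcc _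
  have hcN : ∀ g, c g ≤ N := fun g => by
    obtain ⟨s, hs⟩ := QuotientGroup.mk_out_eq_mul L g
    have := Finset.le_sup (f := fun q : X ⧸ L => c q.out) (Finset.mem_univ (g : X ⧸ L))
    simp only [hs] at this
    rwa [hcmul g _ s.2] at this
  have hNn : N.Normal := by
    refine ⟨fun x hx g => ?_⟩
    have : N ≤ N.comap (MulAut.conj g).toMonoidHom := by
      refine Finset.sup_le fun q _ x hx => hcN (g * q.out) ((hmem _ _).2 ?_)
      have := (hmem _ _).1 hx
      simpa [mul_assoc] using this
    exact this hx
  refine ⟨N, hNn, fun x hx => hcN 1 ?_, hNc⟩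
  rw [hmem]
  simpa using hx

/-- A topological group with a compact subgroup of finite index is compact. -/
theorem compactSpace_of_finiteIndex {X : Type*} [Group X] [TopologicalSpace X]
    [IsTopologicalGroup X] {N : Subgroup X} (hNi : N.FiniteIndex) (hNc : IsCompact (N : Set X)) :
    CompactSpace X := by
  have : Finite (X ⧸ N) := inferInstance
  refine ⟨?_⟩
  have hcov : (Set.univ : Set X) = ⋃ q : X ⧸ N, (fun x => q.out * x) '' (N : Set X) := by
    refine (Set.eq_univ_of_forall fun x : X => Set.mem_iUnion.2 ⟨(x : X ⧸ N), ?_⟩).symm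
    exact ⟨(x : X ⧸ N).out⁻¹ * x, QuotientGroup.eq.1 (QuotientGroup.out_eq' _), by simp⟩
  rw [hcov]
  exact isCompact_iUnion fun q => hNc.image (by fun_prop)

open Topology in
/-- A locally compact group topology on a strongly just infinite profinite group `G` that is finer
than the given one is discrete or compact. The finer topology is that of `X`, with `f` playing the
part of the identity map. -/
theorem discrete_or_compact_of_continuous {X G : Type*} [Group X]
    [TopologicalSpace X] [IsTopologicalGroup X] [LocallyCompactSpace X] [Group G]
    [TopologicalSpace G] [IsTopologicalGroup G] [CompactSpace G]
    [T2Space G] [TotallyDisconnectedSpace G] [FirstCountableTopology G]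
    (hG : BranchGroup.IsStronglyJustInfinite G) (f : X ≃* G) (hf : Continuous f) :
    DiscreteTopology X ∨ CompactSpace X := by
  have : T2Space X := T2Space.of_injective_continuous f.injective hf
  obtain ⟨U, hUo, hUc⟩ := exists_compact_open_subgroup f hf
  -- the closed sets `E k` cover `G`, so that one of them has an interior point `g₀`
  obtain ⟨B, hB⟩ := (𝓝 (1 : G)).exists_antitone_basis
  let E : ℕ → Set G := fun k => {g | ∀ u ∈ U, f u ∈ B k → g * f u * g⁻¹ ∈ f '' U}
  have hEc : ∀ k, IsClosed (E k) := fun k => by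
    simp only [E, Set.ofPred_forall]
    refine isClosed_iInter fun u => isClosed_iInter fun _ => isClosed_iInter fun _ => ?_
    exact (hUc.image hf).isClosed.preimage (by fun_prop)
  have hEu : ⋃ k, E k = Set.univ := by
    refine Set.eq_univ_of_forall fun g => ?_
    obtain ⟨x, rfl⟩ := f.surjective g
    have hx : (fun u => x * u * x⁻¹) ⁻¹' (U : Set X) ∈ 𝓝 (1 : X) :=
      (hUo.preimage (by fun_prop)).mem_nhds (by simp)
    obtain ⟨L, hL⟩ := exists_openNormalSubgroup_inter_preimage_subset f hf hUc hx
    obtain ⟨k, hk⟩ := hB.mem_iff.1 (L.toOpenSubgroup.isOpen.mem_nhds (one_mem L))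
    refine Set.mem_iUnion.2 ⟨k, fun u hu huk => ⟨x * u * x⁻¹, hL u hu (hk huk), by simp⟩⟩
  obtain ⟨k, g₀, hg₀⟩ := nonempty_interior_of_iUnion_of_closed hEc hEu
  -- an open normal subgroup `L₀ ⊆ B k` with `L₀ g₀ ⊆ E k`
  have h1 : (fun s => s * g₀) ⁻¹' interior (E k) ∩ interior (B k) ∈ 𝓝 (1 : G) :=
    ((isOpen_interior.preimage (by fun_prop)).inter isOpen_interior).mem_nhds
      ⟨by simpa using hg₀, mem_interior_iff_mem_nhds.2 (hB.mem k)⟩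
  obtain ⟨L₀, hL₀⟩ := ProfiniteGrp.exist_openNormalSubgroup_sub_open_nhds_of_one
    isOpen_interior (mem_interior_iff_mem_nhds.2 h1)
  replace hL₀ := hL₀.trans interior_subset
  obtain ⟨x₀, rfl⟩ := f.surjective g₀
  let L : Subgroup X := L₀.toSubgroup.comap f.toMonoidHom
  have hLo : IsOpen (L : Set X) := L₀.toOpenSubgroup.isOpen.preimage hf
  have hLc : IsClosed (L : Set X) := L₀.toOpenSubgroup.isClosed.preimage hf
  have hLn : L.Normal := inferInstanceAs (L₀.toSubgroup.comap f.toMonoidHom).Normal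
  have hLi : L.FiniteIndex := by
    have : Subgroup.FiniteIndex L₀.toSubgroup := L₀.toOpenSubgroup.finiteIndex_of_finite_quotient
    exact ⟨by
      rw [Subgroup.index_comap_of_surjective _ f.surjective]
      exact Subgroup.FiniteIndex.index_ne_zero⟩
  have hconj : ∀ s ∈ L, ∀ u ∈ U, u ∈ L → s * (x₀ * u * x₀⁻¹) * s⁻¹ ∈ U := by
    intro s hs u hu huL
    obtain ⟨y, hy, hyu⟩ := interior_subset (hL₀ (show f s ∈ (L₀ : Set G) from hs)).1 u hu
      (interior_subset (hL₀ (show f u ∈ (L₀ : Set G) from huL)).2)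
    have : y = s * (x₀ * u * x₀⁻¹) * s⁻¹ := f.injective (by rw [hyu]; simp [mul_assoc])
    exact this ▸ hy
  by_cases htriv : U ⊓ L = ⊥
  · left
    rw [discreteTopology_iff_isOpen_singleton_one]
    have := hUo.inter hLo
    rwa [← Subgroup.coe_inf, htriv, Subgroup.coe_bot] at this
  right
  -- the closed subgroup generated by the `L`-conjugates of `x₀ (U ∩ L) x₀⁻¹`
  let S : Set X := {x | ∃ s ∈ L, ∃ u ∈ U ⊓ L, x = s * (x₀ * u * x₀⁻¹) * s⁻¹}
  let M : Subgroup X := (Subgroup.closure S).topologicalClosure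
  have hMle : M ≤ U ⊓ L := by
    refine Subgroup.topologicalClosure_minimal _ ((Subgroup.closure_le _).2 ?_)
      (hUc.isClosed.inter hLc)
    rintro _ ⟨s, hs, u, hu, rfl⟩
    exact ⟨hconj s hs u hu.1 hu.2, hLn.conj_mem _ (hLn.conj_mem _ hu.2 _) _⟩
  have hMc : IsCompact (M : Set X) :=
    hUc.of_isClosed_subset (Subgroup.isClosed_topologicalClosure _) fun x hx => (hMle hx).1
  have hMn : ∀ s ∈ L, ∀ x ∈ M, s * x * s⁻¹ ∈ M := by
    intro s hs
    have h : Subgroup.closure S ≤ M.comap (MulAut.conj s).toMonoidHom := by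
      refine (Subgroup.closure_le _).2 ?_
      rintro _ ⟨t, ht, u, hu, rfl⟩
      refine Subgroup.le_topologicalClosure _ (Subgroup.subset_closure
        ⟨s * t, L.mul_mem hs ht, u, hu, ?_⟩)
      simp [mul_assoc]
    have hcl : IsClosed ((M.comap (MulAut.conj s).toMonoidHom : Subgroup X) : Set X) :=
      (Subgroup.isClosed_topologicalClosure _).preimage
        (show Continuous fun x => s * x * s⁻¹ by fun_prop)
    exact fun x hx => Subgroup.topologicalClosure_minimal _ h hcl hx
  have hM1 : M ≠ ⊥ := by
    intro h
    refine htriv ((Subgroup.eq_bot_iff_forall _).2 fun u hu => ?_)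
    have : x₀ * u * x₀⁻¹ ∈ M := Subgroup.le_topologicalClosure _ (Subgroup.subset_closure
        ⟨1, L.one_mem, u, hu, by simp⟩)
    rw [h, Subgroup.mem_bot] at this
    simpa using this
  obtain ⟨N, hNn, hMN, hNc⟩ :=
    exists_compact_normal_ge hLn hLi (hMle.trans inf_le_right) hMn hMc
  have hN1 : N ≠ ⊥ := fun h => hM1 (le_bot_iff.1 (hMN.trans h.le))
  have hNf : (N.map f.toMonoidHom).FiniteIndex :=
    (hG _ (hNn.map _ f.surjective) (by
      rwa [Ne, Subgroup.map_eq_bot_iff_of_injective _ f.injective])).2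
  have hNi : N.FiniteIndex := ⟨by
    rw [← Subgroup.index_map_of_bijective (f := f.toMonoidHom) f.bijective]
    exact hNf.index_ne_zero⟩
  exact compactSpace_of_finiteIndex hNi hNc

/-! ### Automorphisms of the tree -/

section Tree

variable {α : ℕ → ℕ}

theorem Vertex.eq_of_isPrefix {v w : Vertex α} (h : IsPrefix v w) (hl : v.level = w.level) :
    v = w := by
  obtain ⟨n, p⟩ := v
  obtain ⟨m, q⟩ := w
  obtain rfl : n = m := hl
  obtain ⟨_, h⟩ := h
  congr 1
  funext i
  exact (h i).symm

theorem IsPrefix.trans {u v w : Vertex α} (h : IsPrefix u v) (h' : IsPrefix v w) :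
    IsPrefix u w := by
  obtain ⟨h1, h2⟩ := h
  obtain ⟨h3, h4⟩ := h'
  exact ⟨h1.trans h3, fun i => (h4 (Fin.castLE h1 i)).trans (h2 i)⟩

theorem IsPrefix.refl (v : Vertex α) : IsPrefix v v := ⟨le_rfl, fun _ => rfl⟩

/-- The subtrees below two distinct vertices of the same level are disjoint. -/
theorem IsPrefix.eq_of_level_eq {v w x : Vertex α} (h : IsPrefix v x) (h' : IsPrefix w x)
    (hl : v.level = w.level) : v = w := by
  obtain ⟨h1, h2⟩ := h
  obtain ⟨h3, h4⟩ := h'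
  refine Vertex.eq_of_isPrefix ⟨hl.le, fun i => ?_⟩ hl
  rw [← h2, ← h4]
  rfl

/-- The parent of a vertex `w` of positive level; it is a descendant of every proper ancestor
`v` of `w`. -/
theorem exists_isChild {v w : Vertex α} {n : ℕ} (hw : w.level = n + 1) (h : IsPrefix v w)
    (hv : v.level ≤ n) : ∃ p : Vertex α, p.level = n ∧ IsChild p w ∧ IsPrefix v p := by
  have hn : n ≤ w.level := by omega
  obtain ⟨h1, h2⟩ := h
  exact ⟨⟨n, fun i => w.path (Fin.castLE hn i)⟩, rfl, ⟨hw, hn, fun _ => rfl⟩,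
    hv, fun i => h2 i⟩

theorem root_isPrefix (v : Vertex α) : IsPrefix (root α) v :=
  ⟨Nat.zero_le _, fun i => i.elim0⟩

theorem eq_root_of_level_eq_zero {v : Vertex α} (h : v.level = 0) : v = root α :=
  (Vertex.eq_of_isPrefix (root_isPrefix v) h.symm).symm

theorem treeAut.symm_apply (g : treeAut α) (v : Vertex α) : (g⁻¹).1 (g.1 v) = v :=
  g.1.symm_apply_apply v

theorem treeAut.apply_symm (g : treeAut α) (v : Vertex α) : g.1 ((g⁻¹).1 v) = v :=
  g.1.apply_symm_apply v

/-- Automorphisms fixing the root preserve the distance to the root. -/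
theorem treeAut.level_apply (g : treeAut α) (v : Vertex α) : (g.1 v).level = v.level := by
  obtain ⟨n, hn⟩ : ∃ n, v.level = n := ⟨_, rfl⟩
  induction n using Nat.strong_induction_on generalizing g v with
  | _ n ih =>
    obtain _ | n := n
    · have hv := eq_root_of_level_eq_zero hn
      have : g.1 (root α) = root α := g.2
      rw [hv, this]
    · obtain ⟨p, hp, hpv, -⟩ := exists_isChild hn (root_isPrefix v) (Nat.zero_le _)
      have hgp := ih n (by omega) g p hp
      have hadj : (tree α).Adj (g.1 p) (g.1 v) := g.1.map_adj_iff.2 (Or.inl hpv)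
      rcases hadj with h | h
      · have := h.1
        omega
      · -- otherwise `g v` has level `n - 1`, and then so has `v = g⁻¹ (g v)`
        have h1 := h.1
        have := ih (g.1 v).level (by omega) g⁻¹ (g.1 v) rfl
        rw [treeAut.symm_apply] at this
        omega

theorem treeAut.isPrefix_apply (g : treeAut α) {v w : Vertex α} (h : IsPrefix v w) :
    IsPrefix (g.1 v) (g.1 w) := by
  obtain ⟨d, hd⟩ := Nat.exists_eq_add_of_le h.1
  induction d generalizing w with
  | zero =>
    rw [Vertex.eq_of_isPrefix h hd.symm]
    exact IsPrefix.refl _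
  | succ d ih =>
    obtain ⟨p, hp, hpw, hvp⟩ := exists_isChild (n := v.level + d) hd h (by omega)
    refine (ih hvp hp).trans ?_
    have hadj : (tree α).Adj (g.1 p) (g.1 w) := g.1.map_adj_iff.2 (Or.inl hpw)
    rcases hadj with h | h
    · exact h.2
    · have h1 := h.1
      rw [treeAut.level_apply g, treeAut.level_apply g] at h1
      omega

theorem finite_setOf_level_eq (n : ℕ) : {v : Vertex α | v.level = n}.Finite := by
  refine (Set.finite_range fun p : ∀ i : Fin n, Fin (α i) => (⟨n, p⟩ : Vertex α)).subset ?_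
  rintro ⟨m, p⟩ rfl
  exact ⟨p, rfl⟩

theorem countable_vertex : Countable (Vertex α) := by
  refine Function.Surjective.countable
    (f := fun x : Σ n : ℕ, ∀ i : Fin n, Fin (α i) => (⟨x.1, x.2⟩ : Vertex α)) ?_
  rintro ⟨n, p⟩
  exact ⟨⟨n, p⟩, rfl⟩

/-! ### Rigid stabilizers -/

variable {H : Subgroup (treeAut α)}

theorem treeAut.ext_vertex {g h : H} (hgh : ∀ v, g.1.1 v = h.1.1 v) : g = h :=
  Subtype.ext (Subtype.ext (RelIso.ext hgh))

theorem apply_eq_self_of_mem_rigidStabilizer {v : Vertex α} {g : H}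
    (hg : g ∈ rigidStabilizer H v) : g.1.1 v = v := by
  by_contra h
  refine h (g.1.1.injective (hg _ fun hp => h ?_))
  exact (Vertex.eq_of_isPrefix hp (treeAut.level_apply g.1 v).symm).symm

theorem rigidStabilizer_mono {v w : Vertex α} (h : IsPrefix v w) :
    rigidStabilizer H w ≤ rigidStabilizer H v :=
  fun _ hg x hx => hg x fun hw => hx (h.trans hw)

theorem conj_mem_rigidStabilizer (k : H) {g : H} {v : Vertex α} (hg : g ∈ rigidStabilizer H v) :
    k * g * k⁻¹ ∈ rigidStabilizer H (k.1.1 v) := by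
  intro w hw
  have h1 : ¬ IsPrefix v ((k⁻¹).1.1 w) := fun h => hw (by
    have := treeAut.isPrefix_apply k.1 h
    rwa [show k.1.1 ((k⁻¹).1.1 w) = w from treeAut.apply_symm k.1 w] at this)
  change k.1.1 (g.1.1 ((k⁻¹).1.1 w)) = w
  rw [hg _ h1]
  exact treeAut.apply_symm k.1 w

theorem eq_one_of_mem_rigidStabilizer {v w : Vertex α} (hl : v.level = w.level) (hne : v ≠ w)
    {g : H} (hv : g ∈ rigidStabilizer H v) (hw : g ∈ rigidStabilizer H w) : g = 1 :=
  treeAut.ext_vertex fun x => by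
    by_cases hx : IsPrefix v x
    · exact hw x fun h => hne (hx.eq_of_level_eq h hl)
    · exact hv x hx

theorem rigidStabilizer_commute {v w : Vertex α} (hl : v.level = w.level) (hne : v ≠ w)
    {g h : H} (hg : g ∈ rigidStabilizer H v) (hh : h ∈ rigidStabilizer H w) :
    g * h = h * g := by
  refine treeAut.ext_vertex fun x => ?_
  change g.1.1 (h.1.1 x) = h.1.1 (g.1.1 x)
  have hgv := apply_eq_self_of_mem_rigidStabilizer hg
  have hhw := apply_eq_self_of_mem_rigidStabilizer hh
  by_cases hv : IsPrefix v x
  · have h1 : IsPrefix v (g.1.1 x) := by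
      have := treeAut.isPrefix_apply g.1 hv
      rwa [hgv] at this
    rw [hh x fun h => hne (hv.eq_of_level_eq h hl), hh _ fun h => hne (h1.eq_of_level_eq h hl)]
  · rw [hg x hv]
    refine hg _ fun h1 => ?_
    by_cases hw : IsPrefix w x
    · have h2 : IsPrefix w (h.1.1 x) := by
        have := treeAut.isPrefix_apply h.1 hw
        rwa [hhw] at this
      exact hne (h1.eq_of_level_eq h2 hl)
    · rw [hh x hw] at h1
      exact hv h1

/-- If all rigid stabilizers are non-trivial, then the elements commuting with the rigid stabilizer
of `v` fix the subtree below `v`: they normalize the rigid stabilizers of its vertices. -/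
theorem apply_eq_self_of_mem_centralizer (hH : ∀ u, rigidStabilizer H u ≠ ⊥) {v u : Vertex α}
    {x : H} (hx : x ∈ Subgroup.centralizer (rigidStabilizer H v : Set H)) (hu : IsPrefix v u) :
    x.1.1 u = u := by
  by_contra h
  obtain ⟨⟨r, hr⟩, hr1⟩ := (Subgroup.ne_bot_iff_exists_ne_one).1 (hH u)
  have hxr : x * r * x⁻¹ = r := by
    rw [← Subgroup.mem_centralizer_iff.1 hx r (rigidStabilizer_mono hu hr)]
    simp
  refine hr1 (Subtype.ext (eq_one_of_mem_rigidStabilizer (treeAut.level_apply x.1 u) h ?_ hr))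
  have := conj_mem_rigidStabilizer x hr
  rwa [hxr] at this

/-- The stabilizer of a vertex `v` is described in terms of the group structure: it consists of the
elements that conjugate the centralizer of the rigid stabilizer of `v` into itself. -/
theorem apply_eq_self_iff (hH : ∀ u, rigidStabilizer H u ≠ ⊥) (v : Vertex α) (g : H) :
    g.1.1 v = v ↔ ∀ c ∈ Subgroup.centralizer (rigidStabilizer H v : Set H),
      g * c * g⁻¹ ∈ Subgroup.centralizer (rigidStabilizer H v : Set H) := by
  constructor
  · intro hg c hc
    rw [Subgroup.mem_centralizer_iff] at hc ⊢
    intro r hr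
    have hg' : (g⁻¹).1.1 v = v := by
      conv_lhs => rw [← hg]
      exact treeAut.symm_apply g.1 v
    have h := hc (g⁻¹ * r * g) (by
      have := conj_mem_rigidStabilizer g⁻¹ hr
      rwa [hg', inv_inv] at this)
    calc r * (g * c * g⁻¹) = g * ((g⁻¹ * r * g) * c) * g⁻¹ := by group
      _ = g * c * g⁻¹ * r := by rw [h]; group
  · intro hg
    by_contra hne
    -- the rigid stabilizer of `v` centralizes that of `g v`, hence would be abelian
    refine hH v ((Subgroup.eq_bot_iff_forall _).2 fun r hr => treeAut.ext_vertex fun x => ?_)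
    by_cases hx : IsPrefix v x
    · refine apply_eq_self_of_mem_centralizer hH ?_ hx
      have h := hg (g⁻¹ * r * g) ?_
      · simpa [mul_assoc] using h
      · rw [Subgroup.mem_centralizer_iff]
        intro s hs
        have := rigidStabilizer_commute (treeAut.level_apply g.1 v) hne
          (conj_mem_rigidStabilizer g hs) hr
        calc s * (g⁻¹ * r * g) = g⁻¹ * ((g * s * g⁻¹) * r) * g := by group
          _ = g⁻¹ * r * g * s := by rw [this]; group
    · exact hr x hx

/-! ### Topologies on branch groups -/

/-- A Hausdorff group topology on a group of tree automorphisms all of whose rigid stabilizers are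
non-trivial is finer than the topology of pointwise convergence. The finer topology is that of `X`,
with `φ` playing the part of the identity map. -/
theorem continuous_of_t2 {X : Type*} [Group X] [TopologicalSpace X] [IsTopologicalGroup X]
    [T2Space X] (φ : X ≃* H) (hH : ∀ u, rigidStabilizer H u ≠ ⊥) : Continuous φ := by
  have hst : ∀ v : Vertex α, IsClosed {x : X | (φ x).1.1 v = v} := fun v => by
    let C : Subgroup X :=
      (Subgroup.centralizer (rigidStabilizer H v : Set H)).comap φ.toMonoidHom
    have hC : IsClosed (C : Set X) := by
      have : (C : Set X) = Set.centralizer {x | φ x ∈ rigidStabilizer H v} := by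
        ext x
        refine ⟨fun h y hy => φ.injective ?_, fun h => ?_⟩
        · simpa using Subgroup.mem_centralizer_iff.1 h (φ y) hy
        · refine Subgroup.mem_centralizer_iff.2 fun r hr => ?_
          obtain ⟨y, rfl⟩ := φ.surjective r
          simpa using congrArg φ (h y hr)
      rw [this]
      exact Set.isClosed_centralizer _
    have : {x : X | (φ x).1.1 v = v} = {x : X | ∀ c ∈ C, x * c * x⁻¹ ∈ C} := by
      ext x
      rw [Set.mem_ofPred_eq, apply_eq_self_iff hH]
      refine ⟨fun h c hc => ?_, fun h c hc => ?_⟩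
      · change φ (x * c * x⁻¹) ∈ Subgroup.centralizer (rigidStabilizer H v : Set H)
        simpa using h (φ c) hc
      · obtain ⟨y, rfl⟩ := φ.surjective c
        have : φ (x * y * x⁻¹) ∈ Subgroup.centralizer (rigidStabilizer H v : Set H) := h y hc
        simpa using this
    rw [this]
    simp only [Set.ofPred_forall]
    exact isClosed_iInter fun c => isClosed_iInter fun _ => hC.preimage (by fun_prop)
  -- these sets are empty or cosets of stabilizers
  have hcl : ∀ v w : Vertex α, IsClosed {x : X | (φ x).1.1 v = w} := fun v w => by
    by_cases h : ∃ x₀ : X, (φ x₀).1.1 v = w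
    · obtain ⟨x₀, rfl⟩ := h
      have : {x : X | (φ x).1.1 v = (φ x₀).1.1 v} =
          (fun x => x₀⁻¹ * x) ⁻¹' {x : X | (φ x).1.1 v = v} := by
        ext x
        have h1 : (φ (x₀⁻¹ * x)).1.1 v = ((φ x₀).1⁻¹).1 ((φ x).1.1 v) := by
          rw [map_mul, map_inv]
          rfl
        rw [Set.mem_ofPred_eq, Set.mem_preimage, Set.mem_ofPred_eq, h1]
        refine ⟨fun h => ?_, fun h => ?_⟩
        · rw [h]
          exact treeAut.symm_apply (φ x₀).1 v
        · conv_rhs => rw [← h]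
          exact (treeAut.apply_symm (φ x₀).1 _).symm
      rw [this]
      exact (hst v).preimage (by fun_prop)
    · convert isClosed_empty
      ext x
      exact ⟨fun hx => h ⟨x, hx⟩, fun hx => hx.elim⟩
  refine continuous_induced_rng.2 (continuous_induced_rng.2 ?_)
  refine @continuous_pi _ _ _ _ (fun _ => ⊥) _ fun v => ?_
  let : TopologicalSpace (Vertex α) := ⊥
  have : DiscreteTopology (Vertex α) := ⟨rfl⟩
  refine continuous_discrete_rng.2 fun w => ?_
  -- the level of `v` is finite, so the complement is a finite union of closed sets
  have : {x : X | (φ x).1.1 v = w}ᶜ =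
      ⋃ u ∈ {u : Vertex α | u.level = v.level} \ {w}, {x : X | (φ x).1.1 v = u} := by
    ext x
    simp [treeAut.level_apply (φ x).1]
  change IsOpen {x : X | (φ x).1.1 v = w}
  rw [← isClosed_compl_iff, this]
  exact ((finite_setOf_level_eq _).sdiff).isClosed_biUnion fun u _ => hcl v u

/-- A group acting transitively on every level is infinite, as the levels are arbitrarily large. -/
theorem infinite_of_transitive (hα : ∀ i, 2 ≤ α i)
    (ht : ∀ v w : Vertex α, v.level = w.level → ∃ g : H, g.1.1 v = w) : Infinite H := by
  by_contra hfin
  rw [not_infinite_iff_finite] at hfin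
  have : Fintype H := Fintype.ofFinite H
  let n := Fintype.card H + 1
  -- more vertices of level `n` than elements of `H`
  let e : Fin n → Vertex α := fun j =>
    ⟨n, fun i => if i = j then ⟨1, hα i⟩ else ⟨0, (Nat.zero_lt_two).trans_le (hα i)⟩⟩
  choose h hh using fun j => ht (e 0) (e j) rfl
  have hinj : Function.Injective h := fun i j hij => by
    have hij : e i = e j := by rw [← hh i, ← hh j, hij]
    by_contra hne
    have := congrFun (eq_of_heq (Vertex.mk.inj hij).2) i
    simp [hne] at this
  have := Fintype.card_le_of_injective h hinj
  simp [n] at this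

/-- The rigid stabilizers of a branch group are non-trivial: those of a given level are conjugate,
and together they generate a subgroup of finite index in an infinite group. -/
theorem rigidStabilizer_ne_bot (hα : ∀ i, 2 ≤ α i)
    (ht : ∀ v w : Vertex α, v.level = w.level → ∃ g : H, g.1.1 v = w)
    (hr : ∀ n : ℕ, (rigidLevelStabilizer H n).FiniteIndex) (u : Vertex α) :
    rigidStabilizer H u ≠ ⊥ := by
  intro hu
  have := infinite_of_transitive hα ht
  have hbot : rigidLevelStabilizer H u.level = ⊥ := by
    refine le_bot_iff.1 (iSup₂_le fun v hv g hg => ?_)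
    obtain ⟨k, hk⟩ := ht v u hv
    have := conj_mem_rigidStabilizer k hg
    rw [hk, hu, Subgroup.mem_bot] at this
    simpa using this
  have := (hr u.level).index_ne_zero
  rw [hbot, Subgroup.index_bot] at this
  exact this Nat.card_eq_zero_of_infinite

theorem treeAut.firstCountableTopology : FirstCountableTopology (treeAut α) := by
  have := countable_vertex (α := α)
  let : TopologicalSpace (Vertex α) := ⊥
  have : DiscreteTopology (Vertex α) := ⟨rfl⟩
  exact TopologicalSpace.firstCountableTopology_induced _ (Vertex α → Vertex α) _

theorem treeAut.t2Space : T2Space (treeAut α) := by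
  let : TopologicalSpace (Vertex α) := ⊥
  have : DiscreteTopology (Vertex α) := ⟨rfl⟩
  refine T2Space.of_injective_continuous (Y := Vertex α → Vertex α)
    (f := fun (g : treeAut α) v => g.1 v) (fun g h hgh => ?_) continuous_induced_dom
  exact Subtype.ext (RelIso.ext (congrFun hgh))

end Tree

/-- A compact topology finer than a Hausdorff topology is equal to it. -/
theorem eq_of_le_of_compactSpace {Y : Type*} {t τ : TopologicalSpace Y} (hle : t ≤ τ)
    (hc : @CompactSpace Y t) (hT2 : @T2Space Y τ) : t = τ := by
  have h := @Homeomorph.isInducing Y Y t τ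
    (@Continuous.homeoOfEquivCompactToT2 Y Y t τ hc hT2 (Equiv.refl Y) (continuous_id_iff_le.2 hle))
  exact (@Topology.IsInducing.eq_induced Y Y t τ _ h).trans induced_id

end BranchGroup

theorem mainTheorem8 (G : Type*) [Group G] [τ : TopologicalSpace G]
    (hbranch : BranchGroup.IsProfiniteBranchGroup G)
    (hsji : BranchGroup.IsStronglyJustInfinite G) :
    {t : TopologicalSpace G | BranchGroup.IsLocallyCompactGroupTopology G t} = {⊥, τ} ∧
      (⊥ : TopologicalSpace G) ≠ τ := by
  obtain ⟨hG, hc, htd, α, hα, H, -, ⟨φ⟩, ht, hr⟩ := hbranch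
  have hH := BranchGroup.rigidStabilizer_ne_bot hα ht hr
  have := BranchGroup.treeAut.firstCountableTopology (α := α)
  have := BranchGroup.treeAut.t2Space (α := α)
  have : FirstCountableTopology H := Topology.IsInducing.subtypeVal.firstCountableTopology
  have hfc : FirstCountableTopology G := φ.toHomeomorph.isInducing.firstCountableTopology
  have hT2 : T2Space G := T2Space.of_injective_continuous φ.injective φ.continuous
  let ψ : G ≃* H := φ.toMulEquiv
  have hind : τ = TopologicalSpace.induced ψ inferInstance :=
    φ.toHomeomorph.isInducing.eq_induced
  refine ⟨Set.Subset.antisymm ?_ ?_, ?_⟩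
  · rintro t ⟨htg, hlc, ht2⟩
    have hle : t ≤ τ := by
      have h := @BranchGroup.continuous_of_t2 α H G _ t htg ht2 ψ hH
      rw [hind]
      exact continuous_iff_le_induced.1 h
    have hid : @Continuous G G t τ id := continuous_id_iff_le.2 hle
    rcases @BranchGroup.discrete_or_compact_of_continuous G G _ t htg hlc _ τ hG hc hT2 htd hfc
      hsji (MulEquiv.refl G) hid with h | h
    · exact Or.inl h.eq_bot
    · exact Or.inr (BranchGroup.eq_of_le_of_compactSpace hle h hT2)
  · rintro t (rfl | rfl)
    · let : TopologicalSpace G := ⊥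
      have : DiscreteTopology G := ⟨rfl⟩
      exact ⟨inferInstance, inferInstance, inferInstance⟩
    · exact ⟨hG, inferInstance, hT2⟩
  · intro h
    have := BranchGroup.infinite_of_transitive hα ht
    have : Infinite G := Infinite.of_injective φ.symm φ.symm.injective
    have : DiscreteTopology G := ⟨h.symm⟩
    exact not_finite_iff_infinite.2 ‹Infinite G› finite_of_compact_of_discrete
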